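/- Let $n$ agents $1,\dots,n$ each own a dataset. An exchange is a matrix $\mathbf{x}\in[0,1]^{n\times n}$, where $x_{ij}$ is the fraction of agent $i$'s dataset that is shared with agent $j$; the bundle received by agent $j$ is $\mathbf{x}_j=(x_{1j},\dots,x_{nj})\in[0,1]^n$. Let each agent $i$ have a utility function $u_i\colon[0,1]^n\to\mathbb{R}_{\ge 0}$ that is continuous and non-decreasing in every coordinate. Let $\psi_{ij}\colon[0,1]^n\to\mathbb{R}$, for $i,j\in\{1,\dots,n\}$, be continuous share functions ($\psi_{ij}(\mathbf{x}_j)$ measures the contribution of agent $i$ to the utility of agent $j$), that is, continuous functions such that for all $i,j$ and all bundles $\mathbf{x}_j\in[0,1]^n$: - (monotonicity) $\psi_{ij}(\mathbf{x}_j)$ is non-decreasing in $x_{ij}$ when the other coordinates are fixed; - (normalization) $\psi_{ij}(\mathbf{x}_j)=0$ if $x_{ij}=0$; - (efficiency) $\sum_{i=1}^n\psi_{ij}(\mathbf{x}_j)=u_j(\mathbf{x}_j)$. Then there is an exchange $\mathbf{x}\in[0,1]^{n\times n}$ that is both 1. reciprocal: $u_i(\mathbf{x}_i)=\sum_{j=1}^n\psi_{ij}(\mathbf{x}_j)$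 for every agent $i$; and 2. core-stable: there are no nonempty set $S$ of agents and exchange $\mathbf{y}\in[0,1]^{n\times n}$ among the agents in $S$ (that is, $y_{ij}=0$ unless $i,j\in S$; $\mathbf{y}$ need not be reciprocal) such that $u_i(\mathbf{y}_i)>u_i(\mathbf{x}_i)$ for all $i\in S$. -/

import Mathlib

/-- A bundle of data: `b i` is the fraction of agent `i`'s dataset that is received. -/
abbrev Bundle (n : ℕ) : Type := Fin n → Set.Icc (0 : ℝ) 1

/-- An exchange among `n` agents, that is, a point of `[0,1]^{n × n}`:
`x i j` is the fraction of agent `i`'s dataset that is shared with agent `j`. -/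
abbrev Exchange (n : ℕ) : Type := Fin n → Fin n → Set.Icc (0 : ℝ) 1

/-- The bundle `x_j = (x_{1j}, …, x_{nj})` that agent `j` receives in the exchange `x`. -/
def Exchange.bundle {n : ℕ} (x : Exchange n) (j : Fin n) : Bundle n := fun i => x i j

/-- The functions `ψ i j` (the contribution of agent `i` to the utility of agent `j`, as a
function of the bundle of `j`) are share functions for the utilities `u`. -/
structure IsShareFamily {n : ℕ} (u : Fin n → Bundle n → ℝ)
    (ψ : Fin n → Fin n → Bundle n → ℝ) : Prop where
  /-- `ψ i j` is non-decreasing in the coordinate `i`, the other coordinates being fixed. -/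
  monotonicity : ∀ (i j : Fin n) (b : Bundle n),
    Monotone fun t : Set.Icc (0 : ℝ) 1 => ψ i j (Function.update b i t)
  /-- An agent that shares nothing with `j` contributes nothing to `j`. -/
  normalization : ∀ (i j : Fin n) (b : Bundle n), b i = 0 → ψ i j b = 0
  /-- The contributions to agent `j` add up to the utility of agent `j`. -/
  efficiency : ∀ (j : Fin n) (b : Bundle n), ∑ i, ψ i j b = u j b

/-- The surplus of agent `i` in `x`: her total contribution minus her utility. -/
def surplus {n : ℕ} (u : Fin n → Bundle n → ℝ) (ψ : Fin n → Fin n → Bundle n → ℝ)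
    (x : Exchange n) (i : Fin n) : ℝ :=
  ∑ j, ψ i j (x.bundle j) - u i (x.bundle i)

/-- An exchange is reciprocal if every agent has surplus zero. -/
def IsReciprocal {n : ℕ} (u : Fin n → Bundle n → ℝ) (ψ : Fin n → Fin n → Bundle n → ℝ)
    (x : Exchange n) : Prop :=
  ∀ i, surplus u ψ x i = 0

/-- `y` is an exchange among the agents in `S`: data flows only from members of `S` to members
of `S`. -/
def IsExchangeAmong {n : ℕ} (S : Finset (Fin n)) (y : Exchange n) : Prop :=
  ∀ i j, ¬ (i ∈ S ∧ j ∈ S) → y i j = 0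

/-- An exchange is core-stable if no (nonempty) coalition `S` has an exchange among its members
that makes all of them strictly better off. -/
def IsCoreStable {n : ℕ} (u : Fin n → Bundle n → ℝ) (x : Exchange n) : Prop :=
  ¬ ∃ S : Finset (Fin n), S.Nonempty ∧ ∃ y : Exchange n, IsExchangeAmong S y ∧
    ∀ i ∈ S, u i (x.bundle i) < u i (y.bundle i)

/-! Rank the agents by a point `p` of the simplex and let data flow only upwards, up to a continuous
cutoff. Such an exchange is core-stable for every `p`, as the top-ranked member of a coalition
already receives all of the coalition's data; only reciprocity restricts `p`. Choose `p` so that all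
agents of positive rank have maximal surplus (`exists_mem_stdSimplex_forall_le`). Some nonempty set
of such agents has total surplus at most zero: the agents above a gap in the ranks, who give nothing
below it, or everyone if no rank is zero. So the maximal surplus is at most zero, and since
surpluses sum to zero, all vanish. The existence of `p` is a Brouwer-type fact. It comes from
Scarf's lemma, a parity argument on rooms (dominant sets of size `card I`) and doors (sets one
smaller), applied to ever finer grids. -/

/-- For every `y` some order `r i` puts `y` weakly below all of `R`. -/
def Dominant {V I α : Type*} [LinearOrder α] (r : I → V → α) (R : Finset V) : Prop :=
  ∀ y, ∃ i, ∀ x ∈ R, r i y ≤ r i x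

theorem Dominant.mono {V I α : Type*} [LinearOrder α] {r : I → V → α} {R S : Finset V}
    (hR : Dominant r R) (h : S ⊆ R) : Dominant r S := fun y => by
  obtain ⟨i, hi⟩ := hR y
  exact ⟨i, fun x hx => hi x (h hx)⟩

/-! ### Scarf's lemma by a parity count -/

section Scarf

variable {V I α : Type*} [DecidableEq V] [Fintype I] [DecidableEq I] [LinearOrder α]

/-- A dominant extension of `τ` by `y` replaces the minimum of `τ` in one of the two
orders `i`, `j` that share their minimum. -/
theorem dominant_insert_iff {r : I → V → α} (hr : ∀ i, Function.Injective (r i))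
    {τ : Finset V} {m : I → V} (hm : ∀ k, m k ∈ τ) (hmin : ∀ k, ∀ x ∈ τ, r k (m k) ≤ r k x)
    (hτ : Dominant r τ) (hcard : τ.card + 1 = Fintype.card I) {i j : I} (hij : i ≠ j)
    (hmij : m i = m j) (y : V) :
    (y ∉ τ ∧ Dominant r (insert y τ)) ↔
      ∃ a, (a = i ∨ a = j) ∧ (∀ k, k ≠ a → r k (m k) < r k y) ∧
        ∀ z, (∀ k, k ≠ a → r k (m k) < r k z) → r a z ≤ r a y := by
  constructor
  · rintro ⟨hy, hd⟩
    obtain ⟨a, ha⟩ := hd y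
    have key : ∀ x ∈ τ, ∃ k, k ≠ a ∧ m k = x ∧ r k x ≤ r k y := by
      intro x hx
      obtain ⟨k, hk⟩ := hd x
      have hxy : r k x ≤ r k y := hk y (Finset.mem_insert_self _ _)
      refine ⟨k, ?_, ?_, hxy⟩
      · rintro rfl
        have := hr k (le_antisymm hxy (ha x (Finset.mem_insert_of_mem hx)))
        exact hy (this ▸ hx)
      · exact hr k (le_antisymm (hmin k x hx) (hk _ (Finset.mem_insert_of_mem (hm k))))
    -- By `key` the minima in the orders other than `a` exhaust `τ`, which has exactly that many
    -- elements; hence they are distinct, and `a` must be `i` or `j`.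
    have hinj : Set.InjOn m ((Finset.univ.erase a : Finset I) : Set I) := by
      have himg : (Finset.univ.erase a).image m = τ := by
        ext x
        simp only [Finset.mem_image, Finset.mem_erase, Finset.mem_univ, and_true]
        constructor
        · rintro ⟨k, -, rfl⟩
          exact hm k
        · intro hx
          obtain ⟨k, hk, hkx, -⟩ := key x hx
          exact ⟨k, hk, hkx⟩
      rw [← Finset.card_image_iff, himg, Finset.card_erase_of_mem (Finset.mem_univ a),
        Finset.card_univ]
      omega
    have hlt : ∀ k, k ≠ a → r k (m k) < r k y := by
      intro k hk
      obtain ⟨k', hk', hmk, hle⟩ := key (m k) (hm k)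
      have : k' = k := hinj (by simpa using hk') (by simpa using hk) hmk
      subst this
      refine lt_of_le_of_ne hle fun h => hy ?_
      rw [← hr _ h]
      exact hm _
    refine ⟨a, ?_, hlt, ?_⟩
    · by_contra! h
      exact hij (hinj (by simpa using h.1.symm) (by simpa using h.2.symm) hmij)
    · intro z hz
      obtain ⟨k, hk⟩ := hd z
      by_cases hka : k = a
      · subst hka
        exact hk y (Finset.mem_insert_self _ _)
      · exact absurd (hk _ (Finset.mem_insert_of_mem (hm k))) (not_le.2 (hz k hka))
  · rintro ⟨a, haij, hlt, hmax⟩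
    constructor
    · intro hy
      obtain ⟨k, hk⟩ := hτ y
      have hmk : m k = y := hr k (le_antisymm (hmin k y hy) (hk _ (hm k)))
      by_cases hka : k = a
      · subst hka
        rcases haij with rfl | rfl
        · have := hlt j hij.symm
          rw [← hmij, hmk] at this
          exact lt_irrefl _ this
        · have := hlt i hij
          rw [hmij, hmk] at this
          exact lt_irrefl _ this
      · have := hlt k hka
        rw [hmk] at this
        exact lt_irrefl _ this
    · intro z
      by_cases hz : ∀ k, k ≠ a → r k (m k) < r k z
      · obtain ⟨k, hk⟩ := hτ z
        have hka : k = a := by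
          by_contra hka
          exact absurd (hk _ (hm k)) (not_le.2 (hz k hka))
        subst hka
        refine ⟨k, fun x hx => ?_⟩
        rcases Finset.mem_insert.1 hx with rfl | hx
        · exact hmax z hz
        · exact hk x hx
      · push Not at hz
        obtain ⟨k, hka, hk⟩ := hz
        refine ⟨k, fun x hx => ?_⟩
        rcases Finset.mem_insert.1 hx with rfl | hx
        · exact hk.trans (hlt k hka).le
        · exact hk.trans (hmin k x hx)

/-- A room whose labels are not all of `I` has an even number of doors labelled by all of `I`
but `i₀`. -/
theorem even_card_erase_image_eq (ℓ : V → I) (i₀ : I) {R : Finset V}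
    (hcard : R.card = Fintype.card I) (hR : R.image ℓ ≠ Finset.univ) :
    Even (R.filter fun y => (R.erase y).image ℓ = Finset.univ.erase i₀).card := by
  rcases Finset.eq_empty_or_nonempty
    (R.filter fun y => (R.erase y).image ℓ = Finset.univ.erase i₀) with h0 | ⟨y₀, hy₀⟩
  · simp [h0]
  obtain ⟨hy₀R, himg⟩ := Finset.mem_filter.1 hy₀
  have hℓ : ℓ y₀ ≠ i₀ := by
    intro h
    apply hR
    rw [← Finset.insert_erase hy₀R, Finset.image_insert, himg, h,
      Finset.insert_erase (Finset.mem_univ _)]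
  have hinj : Set.InjOn ℓ ((R.erase y₀ : Finset V) : Set V) := by
    rw [← Finset.card_image_iff, himg, Finset.card_erase_of_mem (Finset.mem_univ _),
      Finset.card_erase_of_mem hy₀R, hcard, Finset.card_univ]
  -- The missing label is `i₀`, so the label of `y₀` recurs once, at some `y₁`; deleting either of
  -- the two, and nothing else, leaves such a door.
  have hmem : ℓ y₀ ∈ (R.erase y₀).image ℓ := by
    rw [himg]
    simpa using hℓ
  obtain ⟨y₁, hy₁, hy₁ℓ⟩ := Finset.mem_image.1 hmem
  have hne : y₁ ≠ y₀ := Finset.ne_of_mem_erase hy₁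
  have hy₁R := Finset.mem_of_mem_erase hy₁
  have : (R.filter fun y => (R.erase y).image ℓ = Finset.univ.erase i₀) = {y₀, y₁} := by
    ext y
    simp only [Finset.mem_filter, Finset.mem_insert, Finset.mem_singleton]
    constructor
    · rintro ⟨hyR, hy⟩
      by_contra! hcon
      have hmem : ℓ y ∈ (R.erase y).image ℓ := by
        rw [hy, ← himg]
        exact Finset.mem_image_of_mem ℓ (Finset.mem_erase.2 ⟨hcon.1, hyR⟩)
      obtain ⟨z, hz, hzy⟩ := Finset.mem_image.1 hmem
      have hzne := Finset.ne_of_mem_erase hz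
      have hzR := Finset.mem_of_mem_erase hz
      have hyE : y ∈ R.erase y₀ := Finset.mem_erase.2 ⟨hcon.1, hyR⟩
      by_cases hz0 : z = y₀
      · subst hz0
        exact hcon.2 (hinj hyE hy₁ (by rw [hy₁ℓ, hzy]))
      · exact hzne (hinj (Finset.mem_coe.2 (Finset.mem_erase.2 ⟨hz0, hzR⟩)) hyE hzy)
    · rintro (rfl | rfl)
      · exact ⟨hy₀R, himg⟩
      · refine ⟨hy₁R, ?_⟩
        rw [← himg]
        ext k
        simp only [Finset.mem_image, Finset.mem_erase]
        constructor
        · rintro ⟨x, ⟨hx, hxR⟩, rfl⟩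
          by_cases hx0 : x = y₀
          · exact ⟨y, ⟨hne, hy₁R⟩, by rw [hy₁ℓ, hx0]⟩
          · exact ⟨x, ⟨hx0, hxR⟩, rfl⟩
        · rintro ⟨x, ⟨hx, hxR⟩, rfl⟩
          by_cases hx0 : x = y
          · exact ⟨y₀, ⟨hne.symm, hy₀R⟩, by rw [hx0, hy₁ℓ]⟩
          · exact ⟨x, ⟨hx0, hxR⟩, rfl⟩
  rw [this, Finset.card_pair hne.symm]
  exact even_two

variable [Fintype V]

open Classical in
/-- A door with an element outside the range of the slacks `e` lies in an even number of rooms. -/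
theorem even_card_dominant_insert {r : I → V → α} (hr : ∀ i, Function.Injective (r i))
    {e : I → V} (he : ∀ i k v, k ≠ i → v ∉ Set.range e → r i v < r i (e k))
    {τ : Finset V} (hcard : τ.card + 1 = Fintype.card I) {v : V} (hv : v ∈ τ)
    (hve : v ∉ Set.range e) :
    Even (Finset.univ.filter fun y => y ∉ τ ∧ Dominant r (insert y τ)).card := by
  rcases Finset.eq_empty_or_nonempty
    (Finset.univ.filter fun y => y ∉ τ ∧ Dominant r (insert y τ)) with h0 | ⟨y₀, hy₀⟩
  · simp [h0]
  have hτ : Dominant r τ := (Finset.mem_filter.1 hy₀).2.2.mono (Finset.subset_insert _ _)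
  have hex : ∀ k, ∃ x ∈ τ, ∀ z ∈ τ, r k x ≤ r k z := fun k =>
    Finset.exists_min_image τ (r k) ⟨v, hv⟩
  choose m hm hmin using hex
  obtain ⟨i, -, j, -, hij, hmij⟩ := Finset.exists_ne_map_eq_of_card_lt_of_maps_to
    (s := (Finset.univ : Finset I)) (t := τ) (by rw [Finset.card_univ]; omega)
    (f := m) (fun k _ => hm k)
  have hmax : ∀ a, ∃ y, (∀ k, k ≠ a → r k (m k) < r k y) ∧
      ∀ z, (∀ k, k ≠ a → r k (m k) < r k z) → r a z ≤ r a y := by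
    -- The slack `e a` is a candidate because `τ` contains the non-slack `v`; this is where the
    -- slack door is excluded.
    intro a
    obtain ⟨y, hy, hy'⟩ := Finset.exists_max_image
      (Finset.univ.filter fun y => ∀ k, k ≠ a → r k (m k) < r k y) (r a)
      ⟨e a, by
        simp only [Finset.mem_filter, Finset.mem_univ, true_and]
        exact fun k hk => (hmin k v hv).trans_lt (he k a v hk.symm hve)⟩
    simp only [Finset.mem_filter, Finset.mem_univ, true_and] at hy hy'
    exact ⟨y, hy, hy'⟩
  choose Y hY hYmax using hmax
  -- A common value would exceed the minimum of `τ` in every order, against dominance of `τ`.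
  have hne : Y i ≠ Y j := by
    intro h
    obtain ⟨k, hk⟩ := hτ (Y i)
    refine absurd (hk _ (hm k)) (not_le.2 ?_)
    by_cases hki : k = i
    · rw [h]
      exact hY j k (hki ▸ hij)
    · exact hY i k hki
  have : (Finset.univ.filter fun y => y ∉ τ ∧ Dominant r (insert y τ)) = {Y i, Y j} := by
    ext y
    rw [Finset.mem_filter, dominant_insert_iff hr hm hmin hτ hcard hij hmij]
    simp only [Finset.mem_univ, true_and, Finset.mem_insert, Finset.mem_singleton]
    constructor
    · rintro ⟨a, ha, h1, h2⟩
      have : y = Y a := hr a (le_antisymm (hYmax a y h1) (h2 _ (hY a)))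
      rcases ha with rfl | rfl
      · exact Or.inl this
      · exact Or.inr this
    · rintro (rfl | rfl)
      · exact ⟨i, Or.inl rfl, hY i, hYmax i⟩
      · exact ⟨j, Or.inr rfl, hY j, hYmax j⟩
  rw [this, Finset.card_pair hne]
  exact even_two

open Classical in
/-- The door consisting of all slacks but one lies in exactly one room. -/
theorem card_dominant_insert_slack {r : I → V → α} (hr : ∀ i, Function.Injective (r i))
    {e : I → V} (hmin : ∀ i v, r i (e i) ≤ r i v)
    (he : ∀ i k v, k ≠ i → v ∉ Set.range e → r i v < r i (e k))
    (hV : ∃ v, v ∉ Set.range e) (i₀ : I) :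
    (Finset.univ.filter fun y => y ∉ (Finset.univ.erase i₀).image e ∧
      Dominant r (insert y ((Finset.univ.erase i₀).image e))).card = 1 := by
  -- The only completion is the non-slack vertex that is largest in the order `i₀`.
  obtain ⟨v, hv⟩ := hV
  obtain ⟨Y, hY, hYmax⟩ := Finset.exists_max_image
    (Finset.univ.filter fun y => y ∉ Set.range e) (r i₀) ⟨v, by simpa using hv⟩
  simp only [Finset.mem_filter, Finset.mem_univ, true_and] at hY hYmax
  have hns : ∀ i y, y ∉ Set.range e → ¬ r i y ≤ r i (e i) := fun i y hy h =>
    hy ⟨i, hr i (le_antisymm (hmin i y) h)⟩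
  rw [Finset.card_eq_one]
  refine ⟨Y, ?_⟩
  ext y
  simp only [Finset.mem_filter, Finset.mem_univ, true_and, Finset.mem_singleton]
  constructor
  · rintro ⟨hy, hd⟩
    have hzmem : ∀ z, z ∉ Set.range e → ∀ k,
        (∀ x ∈ insert y ((Finset.univ.erase i₀).image e), r k z ≤ r k x) → k = i₀ := by
      intro z hz k hk
      by_contra hki
      exact hns k z hz (hk _ (Finset.mem_insert_of_mem
        (Finset.mem_image_of_mem e (by simpa using hki))))
    have hle : ∀ z, z ∉ Set.range e → r i₀ z ≤ r i₀ y := by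
      intro z hz
      obtain ⟨k, hk⟩ := hd z
      obtain rfl := hzmem z hz k hk
      exact hk y (Finset.mem_insert_self _ _)
    have hye : y ∉ Set.range e := by
      rintro ⟨k, rfl⟩
      by_cases hk : k = i₀
      · subst hk
        exact hns _ v hv (hle v hv)
      · exact hy (Finset.mem_image_of_mem e (by simpa using hk))
    exact hr i₀ (le_antisymm (hYmax y hye) (hle Y hY))
  · rintro rfl
    refine ⟨?_, ?_⟩
    · intro h
      obtain ⟨k, -, hk⟩ := Finset.mem_image.1 h
      exact hY ⟨k, hk⟩
    · intro z
      by_cases hz : z ∈ Set.range e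
      · obtain ⟨k, rfl⟩ := hz
        exact ⟨k, fun x _ => hmin k x⟩
      · refine ⟨i₀, fun x hx => ?_⟩
        rcases Finset.mem_insert.1 hx with rfl | hx
        · exact hYmax z hz
        · obtain ⟨k, hk, rfl⟩ := Finset.mem_image.1 hx
          exact (he i₀ k z (Finset.ne_of_mem_erase hk) hz).le

open Classical in
/-- **Scarf's lemma**: there is a dominant set that carries all labels. -/
theorem exists_dominant_image_eq_univ [Nonempty I] {r : I → V → α}
    (hr : ∀ i, Function.Injective (r i)) {e : I → V} (hmin : ∀ i v, r i (e i) ≤ r i v)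
    (he : ∀ i k v, k ≠ i → v ∉ Set.range e → r i v < r i (e k))
    (hV : ∃ v, v ∉ Set.range e) (ℓ : V → I) (hℓ : ∀ i, ℓ (e i) = i) :
    ∃ R : Finset V, Dominant r R ∧ R.image ℓ = Finset.univ := by
  by_contra! hcon
  obtain ⟨i₀⟩ := ‹Nonempty I›
  have hI : 0 < Fintype.card I := Fintype.card_pos_iff.2 ⟨i₀⟩
  set D : Finset (Finset V) := Finset.univ.filter fun τ =>
    τ.card + 1 = Fintype.card I ∧ τ.image ℓ = Finset.univ.erase i₀ with hD
  set Q : Finset (Finset V) := Finset.univ.filter fun R =>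
    R.card = Fintype.card I ∧ Dominant r R with hQ
  -- Both sides count incidences between doors and rooms. Without a fully labelled room the right
  -- side is even, while on the left only the slack door contributes an odd number.
  have hcount : ∑ τ ∈ D, (Finset.univ.filter fun y => y ∉ τ ∧ Dominant r (insert y τ)).card =
      ∑ R ∈ Q, (R.filter fun y => (R.erase y).image ℓ = Finset.univ.erase i₀).card := by
    rw [← Finset.card_sigma, ← Finset.card_sigma]
    refine Finset.card_bij' (fun p _ => ⟨insert p.2 p.1, p.2⟩) (fun p _ => ⟨p.1.erase p.2, p.2⟩)
      ?_ ?_ ?_ ?_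
    · rintro ⟨τ, y⟩ h
      simp only [hD, hQ, Finset.mem_sigma, Finset.mem_filter, Finset.mem_univ, true_and] at h ⊢
      refine ⟨⟨?_, h.2.2⟩, Finset.mem_insert_self _ _, ?_⟩
      · rw [Finset.card_insert_of_notMem h.2.1, h.1.1]
      · rw [Finset.erase_insert h.2.1, h.1.2]
    · rintro ⟨R, y⟩ h
      simp only [hD, hQ, Finset.mem_sigma, Finset.mem_filter, Finset.mem_univ, true_and] at h ⊢
      refine ⟨⟨?_, h.2.2⟩, Finset.notMem_erase _ _, ?_⟩
      · rw [Finset.card_erase_of_mem h.2.1, h.1.1]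
        omega
      · rw [Finset.insert_erase h.2.1]
        exact h.1.2
    · rintro ⟨τ, y⟩ h
      simp only [Finset.mem_sigma, Finset.mem_filter, Finset.mem_univ, true_and] at h
      simp [Finset.erase_insert h.2.1]
    · rintro ⟨R, y⟩ h
      simp only [Finset.mem_sigma, Finset.mem_filter] at h
      simp [Finset.insert_erase h.2.1]
  have heven : Even (∑ R ∈ Q,
      (R.filter fun y => (R.erase y).image ℓ = Finset.univ.erase i₀).card) := by
    refine Finset.even_sum _ fun R hR => ?_
    simp only [hQ, Finset.mem_filter, Finset.mem_univ, true_and] at hR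
    exact even_card_erase_image_eq ℓ i₀ hR.1 (hcon R hR.2)
  have heinj : Function.Injective e := fun a b h => by rw [← hℓ a, h, hℓ]
  have hτ₀ : (Finset.univ.erase i₀).image e ∈ D := by
    simp only [hD, Finset.mem_filter, Finset.mem_univ, true_and]
    constructor
    · rw [Finset.card_image_of_injective _ heinj, Finset.card_erase_of_mem (Finset.mem_univ _),
        Finset.card_univ]
      omega
    · rw [Finset.image_image]
      have : ℓ ∘ e = id := funext hℓ
      rw [this, Finset.image_id]
  rw [← hcount, ← Finset.add_sum_erase D _ hτ₀, card_dominant_insert_slack hr hmin he hV i₀]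
    at heven
  have hrest : Even (∑ τ ∈ D.erase ((Finset.univ.erase i₀).image e),
      (Finset.univ.filter fun y => y ∉ τ ∧ Dominant r (insert y τ)).card) := by
    refine Finset.even_sum _ fun τ hτ => ?_
    obtain ⟨hne, hτD⟩ := Finset.mem_erase.1 hτ
    simp only [hD, Finset.mem_filter, Finset.mem_univ, true_and] at hτD
    by_cases h : ∃ v ∈ τ, v ∉ Set.range e
    · obtain ⟨v, hv, hve⟩ := h
      exact even_card_dominant_insert hr he hτD.1 hv hve
    · push Not at h
      refine absurd ?_ hne
      refine Finset.eq_of_subset_of_card_le ?_ ?_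
      · intro v hv
        obtain ⟨k, rfl⟩ := h v hv
        refine Finset.mem_image_of_mem e ?_
        rw [← hτD.2]
        exact Finset.mem_image.2 ⟨e k, hv, hℓ k⟩
      · rw [Finset.card_image_of_injective _ heinj, Finset.card_erase_of_mem (Finset.mem_univ _),
          Finset.card_univ]
        omega
  exact absurd heven (by rw [Nat.even_add]; simp [hrest])

end Scarf

/-! ### From grid labellings to a variational inequality -/

/-- The points of the `N`-th grid of the simplex, with a slack vertex for each coordinate. -/
abbrev GridVertex (I : Type*) [Fintype I] [DecidableEq I] (N : ℕ) : Type _ :=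
  (Finset.piAntidiag (Finset.univ : Finset I) N) ⊕ I

/-- The `i`-th coordinate of a grid point; a slack vertex lies below the grid in its own
coordinate and above it in the others. -/
def GridVertex.coord {I : Type*} [Fintype I] [DecidableEq I] {N : ℕ} (i : I) :
    GridVertex I N → ℤ
  | .inl x => x.1 i
  -- Both values lie outside the range `0, …, N` of grid coordinates, which gives the strict
  -- inequalities demanded of slacks.
  | .inr k => if k = i then -1 else N + 1

/-- In any labelling of the grid points of a simplex there is a grid point `q` such that, for
each `k`, either the coordinate `q k` is small or there is a point close to `q` labelled `k`. -/
theorem exists_grid_point_close_to_labels {I : Type*} [Fintype I] [DecidableEq I] [Nonempty I]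
    (N : ℕ) (c : (I → ℕ) → I) :
    ∃ q : I → ℕ, ∑ i, q i = N ∧ ∀ k, q k < Fintype.card I ∨
      ∃ x : I → ℕ, ∑ i, x i = N ∧ c x = k ∧
        ∀ i, q i < x i + Fintype.card I ∧ x i < q i + Fintype.card I := by
  classical
  have hsum : ∀ x : Finset.piAntidiag (Finset.univ : Finset I) N, ∑ i, x.1 i = N :=
    fun x => (Finset.mem_piAntidiag.1 x.2).1
  have hle : ∀ (x : Finset.piAntidiag (Finset.univ : Finset I) N) i, x.1 i ≤ N := fun x i => by
    exact (Finset.single_le_sum (f := x.1) (fun _ _ => Nat.zero_le _) (Finset.mem_univ i)).trans_eq (hsum x)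
  let s := Fintype.equivFin (GridVertex I N)
  -- The enumeration `s` breaks ties, making each order injective.
  let r : I → GridVertex I N → ℤ ×ₗ Fin (Fintype.card (GridVertex I N)) :=
    fun i v => toLex (GridVertex.coord i v, s v)
  have hlt : ∀ i v w, GridVertex.coord i v < GridVertex.coord i w → r i v < r i w :=
    fun i v w h => Prod.Lex.toLex_lt_toLex.2 (Or.inl h)
  have hlex : ∀ i v w, r i v ≤ r i w → GridVertex.coord i v ≤ GridVertex.coord i w := by
    intro i v w h
    by_contra! hcon
    exact absurd h (not_le.2 (hlt _ _ _ hcon))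
  have hr : ∀ i, Function.Injective (r i) := fun i v w h =>
    s.injective (congrArg (fun p => (ofLex p).2) h)
  have hns : ∀ v : GridVertex I N, v ∉ Set.range (Sum.inr : I → GridVertex I N) →
      ∃ x, v = Sum.inl x := by
    rintro (x | k) h
    · exact ⟨x, rfl⟩
    · exact absurd ⟨k, rfl⟩ h
  obtain ⟨i₁⟩ := ‹Nonempty I›
  have hx₀ : Pi.single i₁ N ∈ Finset.piAntidiag (Finset.univ : Finset I) N := by
    rw [Finset.mem_piAntidiag]
    exact ⟨by simp, fun _ _ => Finset.mem_univ _⟩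
  obtain ⟨R, hdom, hR⟩ := exists_dominant_image_eq_univ (V := GridVertex I N) hr
    (e := Sum.inr) (by
      rintro i (x | k)
      · refine (hlt _ _ _ ?_).le
        simp only [GridVertex.coord, if_true]
        omega
      · by_cases hk : k = i
        · rw [hk]
        · refine (hlt _ _ _ ?_).le
          simp only [GridVertex.coord, if_true, if_neg hk]
          omega)
    (by
      intro i k v hk hv
      obtain ⟨x, rfl⟩ := hns v hv
      refine hlt _ _ _ ?_
      have := hle x i
      simp only [GridVertex.coord, if_neg hk]
      omega)
    ⟨Sum.inl ⟨_, hx₀⟩, by simp⟩ (Sum.elim (fun x => c x.1) id) (fun _ => rfl)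
  -- Labels in `C` must come from grid points of `R`, and grid points can be dominated only in
  -- coordinates of `C`.
  set C : Finset I := Finset.univ.filter fun i => Sum.inr i ∉ R with hC
  have hlab : ∀ k ∈ C, ∃ x, Sum.inl x ∈ R ∧ c x.1 = k := by
    intro k hk
    have hmem : k ∈ R.image (Sum.elim (fun x => c x.1) id) := by rw [hR]; exact Finset.mem_univ k
    obtain ⟨v, hv, hvk⟩ := Finset.mem_image.1 hmem
    rcases v with x | l
    · exact ⟨x, hv, hvk⟩
    · obtain rfl : l = k := hvk
      exact absurd hv (Finset.mem_filter.1 hk).2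
  have hdomC : ∀ y : Finset.piAntidiag (Finset.univ : Finset I) N,
      ∃ i ∈ C, ∀ x, Sum.inl x ∈ R → y.1 i ≤ x.1 i := by
    intro y
    obtain ⟨i, hi⟩ := hdom (Sum.inl y)
    refine ⟨i, ?_, fun x hx => ?_⟩
    · simp only [hC, Finset.mem_filter, Finset.mem_univ, true_and]
      intro hiR
      have := hlex _ _ _ (hi _ hiR)
      simp only [GridVertex.coord, if_true] at this
      omega
    · have := hlex _ _ _ (hi _ hx)
      simp only [GridVertex.coord] at this
      exact_mod_cast this
  obtain ⟨i₂, hi₂, -⟩ := hdomC ⟨_, hx₀⟩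
  obtain ⟨q, hq, -⟩ := hlab i₂ hi₂
  have hmin : ∀ i, ∃ x, Sum.inl x ∈ R ∧ ∀ z, Sum.inl z ∈ R → x.1 i ≤ z.1 i := by
    intro i
    obtain ⟨x, hx, hx'⟩ := Finset.exists_min_image
      (Finset.univ.filter fun x => (Sum.inl x : GridVertex I N) ∈ R) (fun x => x.1 i)
      ⟨q, by simpa using hq⟩
    simp only [Finset.mem_filter, Finset.mem_univ, true_and] at hx hx'
    exact ⟨x, hx, hx'⟩
  choose w hw hwmin using hmin
  -- Otherwise there is room for a grid point `y` exceeding the minimum of `R` in every coordinate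
  -- of `C`, with the leftover mass put on `i₂`; no order would dominate it.
  have hlow : N < ∑ i ∈ C, ((w i).1 i + 1) := by
    by_contra! hcon
    let y : I → ℕ := fun i => (if i ∈ C then (w i).1 i + 1 else 0) +
      if i = i₂ then N - ∑ i ∈ C, ((w i).1 i + 1) else 0
    have hy : y ∈ Finset.piAntidiag (Finset.univ : Finset I) N := by
      rw [Finset.mem_piAntidiag]
      refine ⟨?_, fun _ _ => Finset.mem_univ _⟩
      simp only [y, Finset.sum_add_distrib, Finset.sum_ite_mem, Finset.univ_inter,
        Finset.sum_ite_eq', Finset.mem_univ, if_true] at hcon ⊢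
      omega
    obtain ⟨i, hi, hi'⟩ := hdomC ⟨y, hy⟩
    have := hi' (w i) (hw i)
    simp only [y, if_pos hi] at this
    omega
  have hCcard : C.card ≤ Fintype.card I := Finset.card_le_univ C
  have hpos : 0 < C.card := Finset.card_pos.2 ⟨i₂, hi₂⟩
  rw [Finset.sum_add_distrib, Finset.sum_const, smul_eq_mul, mul_one] at hlow
  -- The minima over `C` already use more than `N - C.card` of the total mass `N`, so less than
  -- `C.card` is left for any deviation.
  have hin : ∀ z, Sum.inl z ∈ R → ∀ i ∈ C, z.1 i < (w i).1 i + Fintype.card I := by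
    intro z hz i hi
    have h1 : ∑ i ∈ C, z.1 i ≤ N := by
      exact (Finset.sum_le_sum_of_subset (Finset.subset_univ C)).trans_eq (hsum z)
    rw [← Finset.add_sum_erase _ _ hi] at h1 hlow
    have h2 : ∑ i ∈ C.erase i, (w i).1 i ≤ ∑ i ∈ C.erase i, z.1 i :=
      Finset.sum_le_sum fun k _ => hwmin k z hz
    omega
  have hout : ∀ z, Sum.inl z ∈ R → ∀ i ∉ C, z.1 i < Fintype.card I := by
    intro z hz i hi
    have h1 : ∑ i ∈ insert i C, z.1 i ≤ N := by
      exact (Finset.sum_le_sum_of_subset (Finset.subset_univ _)).trans_eq (hsum z)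
    rw [Finset.sum_insert hi] at h1
    have h2 : ∑ i ∈ C, (w i).1 i ≤ ∑ i ∈ C, z.1 i :=
      Finset.sum_le_sum fun k _ => hwmin k z hz
    omega
  refine ⟨q.1, hsum q, fun k => ?_⟩
  by_cases hk : k ∈ C
  · obtain ⟨x, hx, hxk⟩ := hlab k hk
    refine Or.inr ⟨x.1, hsum x, hxk, fun i => ?_⟩
    by_cases hi : i ∈ C
    · have := hin q hq i hi
      have := hin x hx i hi
      have := hwmin i q hq
      have := hwmin i x hx
      omega
    · have := hout q hq i hi
      have := hout x hx i hi
      omega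
  · exact Or.inl (hout q hq k hk)

/-- A continuous map on the standard simplex has a point at which every coordinate in the support
maximizes the value of the map, up to an arbitrarily small error. -/
theorem exists_mem_stdSimplex_min_le {I : Type*} [Fintype I] [Nonempty I]
    {F : (I → ℝ) → I → ℝ} (hF : Continuous F) {ε : ℝ} (hε : 0 < ε) :
    ∃ p ∈ stdSimplex ℝ I, ∀ k j, min (p k) (F p j - F p k) ≤ ε := by
  classical
  have hunif : UniformContinuousOn F (stdSimplex ℝ I) :=
    (isCompact_stdSimplex ℝ I).uniformContinuousOn_of_continuous hF.continuousOn
  obtain ⟨δ, hδ, hδF⟩ := Metric.uniformContinuousOn_iff.1 hunif (ε / 2) (by positivity)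
  obtain ⟨N, hN⟩ := exists_nat_gt ((Fintype.card I : ℝ) / min δ ε)
  have hmin : 0 < min δ ε := lt_min hδ hε
  have hN0 : (0 : ℝ) < N := lt_of_le_of_lt (by positivity) hN
  have hsmall : (Fintype.card I : ℝ) / N < min δ ε := by
    rw [div_lt_iff₀ hmin] at hN
    rw [div_lt_iff₀ hN0]
    linarith
  let P : (I → ℕ) → I → ℝ := fun x i => x i / N
  have hP : ∀ x : I → ℕ, ∑ i, x i = N → P x ∈ stdSimplex ℝ I := by
    intro x hx
    refine ⟨fun i => by positivity, ?_⟩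
    rw [← Finset.sum_div, ← Nat.cast_sum, hx, div_self hN0.ne']
  have hmax : ∀ x : I → ℕ, ∃ k, ∀ j, F (P x) j ≤ F (P x) k := fun x => by
    obtain ⟨k, -, hk⟩ := Finset.exists_max_image Finset.univ (F (P x)) Finset.univ_nonempty
    exact ⟨k, fun j => hk j (Finset.mem_univ j)⟩
  choose c hc using hmax
  obtain ⟨q, hq, hqk⟩ := exists_grid_point_close_to_labels N c
  refine ⟨P q, hP q hq, fun k j => ?_⟩
  rcases hqk k with h | ⟨x, hx, rfl, hclose⟩
  · refine (min_le_left _ _).trans ?_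
    have h1 : (q k : ℝ) / N ≤ Fintype.card I / N := by gcongr
    exact h1.trans (hsmall.le.trans (min_le_right _ _))
  -- The label of `x` maximizes `F` at `P x`; moving to `P q` costs `ε / 2` in each of the two
  -- coordinates compared.
  · refine (min_le_right _ _).trans ?_
    have hd : dist (P x) (P q) < δ := by
      refine lt_of_le_of_lt ?_ (hsmall.trans_le (min_le_left _ _))
      rw [dist_pi_le_iff (by positivity)]
      intro i
      have h1 : (q i : ℝ) < x i + Fintype.card I := by exact_mod_cast (hclose i).1
      have h2 : (x i : ℝ) < q i + Fintype.card I := by exact_mod_cast (hclose i).2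
      rw [Real.dist_eq, ← sub_div, abs_div, abs_of_pos hN0]
      gcongr
      exact abs_le.2 ⟨by linarith, by linarith⟩
    have hFd := hδF _ (hP x hx) _ (hP q hq) hd
    have hcoord : ∀ i, |F (P x) i - F (P q) i| < ε / 2 := fun i =>
      (dist_le_pi_dist _ _ i).trans_lt hFd
    have h1 := abs_lt.1 (hcoord j)
    have h2 := abs_lt.1 (hcoord (c x))
    have h3 := hc x j
    linarith [h1.1, h2.2]

/-- The variational inequality of a continuous map on the standard simplex has a solution. -/
theorem exists_mem_stdSimplex_forall_le {I : Type*} [Fintype I] [Nonempty I]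
    {F : (I → ℝ) → I → ℝ} (hF : Continuous F) :
    ∃ p ∈ stdSimplex ℝ I, ∀ k, 0 < p k → ∀ j, F p j ≤ F p k := by
  have happrox : ∀ m : ℕ, ∃ p ∈ stdSimplex ℝ I, ∀ k j,
      min (p k) (F p j - F p k) ≤ 1 / ((m : ℝ) + 1) := fun m =>
    exists_mem_stdSimplex_min_le hF (by positivity)
  choose q hq hqle using happrox
  obtain ⟨p, hp, φ, hφ, hlim⟩ := (isCompact_stdSimplex ℝ I).tendsto_subseq hq
  refine ⟨p, hp, fun k hk j => ?_⟩
  -- The minimum turns the implication into a closed condition, which survives the limit.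
  have hcont : Continuous fun p : I → ℝ => min (p k) (F p j - F p k) := by fun_prop
  have hle : min (p k) (F p j - F p k) ≤ 0 :=
    le_of_tendsto_of_tendsto' ((hcont.tendsto p).comp hlim)
      (tendsto_one_div_add_atTop_nhds_zero_nat.comp hφ.tendsto_atTop) fun m => hqle (φ m) k j
  rcases min_le_iff.1 hle with h | h
  · exact absurd h (not_le.2 hk)
  · linarith

/-! ### Rank exchanges and surpluses -/

/-- The exchange induced by a vector `p` of ranks: an agent shares everything with the agents
that rank at least as high, and nothing with those that rank lower by at least `1 / K`. -/
noncomputable def rankExchange {n : ℕ} (K : ℝ) (p : Fin n → ℝ) : Exchange n :=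
  fun i j => Set.projIcc 0 1 zero_le_one (1 - K * (p i - p j))

theorem rankExchange_eq_one {n : ℕ} {K : ℝ} (hK : 0 ≤ K) {p : Fin n → ℝ} {i j : Fin n}
    (h : p i ≤ p j) : rankExchange K p i j = 1 :=
  Set.projIcc_of_right_le _ (by nlinarith)

theorem rankExchange_eq_zero {n : ℕ} {K : ℝ} {p : Fin n → ℝ} {i j : Fin n}
    (h : 1 ≤ K * (p i - p j)) : rankExchange K p i j = 0 :=
  Set.projIcc_of_le_left _ (by linarith)

theorem continuous_rankExchange {n : ℕ} (K : ℝ) :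
    Continuous (rankExchange K : (Fin n → ℝ) → Exchange n) := by
  refine continuous_pi fun i => continuous_pi fun j => ?_
  exact continuous_projIcc.comp (by fun_prop)

/-- In any coalition the agent of highest rank already receives all data of the coalition. -/
theorem isCoreStable_rankExchange {n : ℕ} {u : Fin n → Bundle n → ℝ}
    (hu : ∀ i, Monotone (u i)) {K : ℝ} (hK : 0 ≤ K) (p : Fin n → ℝ) :
    IsCoreStable u (rankExchange K p) := by
  rintro ⟨S, hS, y, hy, hlt⟩
  obtain ⟨i, hi, hmax⟩ := Finset.exists_max_image S p hS
  refine absurd (hlt i hi) (not_lt.2 (hu i fun j => ?_))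
  by_cases hj : j ∈ S
  · have : (rankExchange K p).bundle i j = 1 := rankExchange_eq_one hK (hmax j hj)
    rw [this]
    exact (y j i).2.2
  · have : y.bundle i j = 0 := hy j i fun h => hj h.1
    rw [this]
    exact ((rankExchange K p).bundle i j).2.1

theorem IsShareFamily.nonneg {n : ℕ} {u : Fin n → Bundle n → ℝ}
    {ψ : Fin n → Fin n → Bundle n → ℝ} (hψ : IsShareFamily u ψ) (i j : Fin n) (b : Bundle n) :
    0 ≤ ψ i j b := by
  have h := hψ.monotonicity i j b (show (0 : Set.Icc (0 : ℝ) 1) ≤ b i from (b i).2.1)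
  simp only [Function.update_eq_self] at h
  rwa [hψ.normalization i j _ (Function.update_self i _ b)] at h

/-- By efficiency each contribution counts once for its giver and once against its receiver. -/
theorem IsShareFamily.sum_surplus {n : ℕ} {u : Fin n → Bundle n → ℝ}
    {ψ : Fin n → Fin n → Bundle n → ℝ} (hψ : IsShareFamily u ψ) (x : Exchange n) :
    ∑ i, surplus u ψ x i = 0 := by
  simp only [surplus, Finset.sum_sub_distrib, ← hψ.efficiency]
  rw [Finset.sum_comm, sub_self]

/-- A set of agents that shares nothing with the others has nonpositive total surplus. -/
theorem IsShareFamily.sum_surplus_nonpos {n : ℕ} {u : Fin n → Bundle n → ℝ}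
    {ψ : Fin n → Fin n → Bundle n → ℝ} (hψ : IsShareFamily u ψ) {x : Exchange n}
    {U : Finset (Fin n)} (hU : ∀ i ∈ U, ∀ j ∉ U, x i j = 0) :
    ∑ i ∈ U, surplus u ψ x i ≤ 0 := by
  simp only [surplus, Finset.sum_sub_distrib, ← hψ.efficiency]
  have h1 : ∑ i ∈ U, ∑ j, ψ i j (x.bundle j) = ∑ i ∈ U, ∑ j ∈ U, ψ i j (x.bundle j) := by
    refine Finset.sum_congr rfl fun i hi => ?_
    refine (Finset.sum_subset (Finset.subset_univ U) fun j _ hj => ?_).symm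
    exact hψ.normalization i j _ (hU i hi j hj)
  have h2 : ∑ j ∈ U, ∑ i ∈ U, ψ i j (x.bundle j) ≤ ∑ j ∈ U, ∑ i, ψ i j (x.bundle j) :=
    Finset.sum_le_sum fun j _ => Finset.sum_le_sum_of_subset_of_nonneg (Finset.subset_univ U)
      fun i _ _ => hψ.nonneg i j _
  rw [h1, Finset.sum_comm]
  linarith

/-- Among the coordinates of a point of the simplex with a zero coordinate there is a gap of
length `1 / n ^ 2`. -/
theorem exists_gap_of_mem_stdSimplex {n : ℕ} {p : Fin n → ℝ} (hp : p ∈ stdSimplex ℝ (Fin n))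
    {k : Fin n} (hk : p k = 0) :
    ∃ U : Finset (Fin n), U.Nonempty ∧ (∀ i ∈ U, 0 < p i) ∧
      ∀ i ∈ U, ∀ j ∉ U, 1 ≤ (n : ℝ) ^ 2 * (p i - p j) := by
  have hn : 0 < n := k.pos
  have hn' : (0 : ℝ) < n := by exact_mod_cast hn
  let A : ℕ → Finset (Fin n) := fun l => Finset.univ.filter fun i => (n : ℝ) ^ 2 * p i ≤ l
  have hA : ∀ l i, i ∈ A l ↔ (n : ℝ) ^ 2 * p i ≤ l := by simp [A]
  have hmono : ∀ l, A l ⊆ A (l + 1) := fun l i hi => by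
    rw [hA] at hi ⊢
    push_cast
    linarith
  have hne : A (n - 1) ≠ Finset.univ := by
    intro h
    have h1 : ∀ i, p i ≤ (n - 1) / (n : ℝ) ^ 2 := by
      intro i
      have : i ∈ A (n - 1) := by rw [h]; exact Finset.mem_univ i
      rw [hA, Nat.cast_sub hn, Nat.cast_one] at this
      rw [le_div_iff₀ (by positivity)]
      linarith
    have h2 : ∑ i, p i ≤ ∑ _i : Fin n, (n - 1) / (n : ℝ) ^ 2 :=
      Finset.sum_le_sum fun i _ => h1 i
    rw [hp.2, Finset.sum_const, Finset.card_univ, Fintype.card_fin, nsmul_eq_mul] at h2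
    have h3 : (n : ℝ) * ((n - 1) / (n : ℝ) ^ 2) = (n - 1) / n := by field_simp
    rw [h3, le_div_iff₀ hn'] at h2
    linarith
  -- The sets `A l` start with at least `k`; if each step up to `n - 1` were strict, `A (n - 1)`
  -- would be everything, forcing a coordinate sum of at most `(n - 1) / n`.
  have hgap : ∃ l, l + 1 < n ∧ A l = A (l + 1) := by
    by_contra! hcon
    have hcard : ∀ l, l < n → l + 1 ≤ (A l).card := by
      intro l
      induction l with
      | zero =>
        intro _
        exact Finset.card_pos.2 ⟨k, by simp [hA, hk]⟩
      | succ l ih =>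
        intro hl
        have := Finset.card_lt_card ((hmono l).ssubset_of_ne (hcon l hl))
        have := ih (by omega)
        omega
    have h1 := hcard (n - 1) (by omega)
    refine hne (Finset.eq_univ_of_card _ (le_antisymm (Finset.card_le_univ _) ?_))
    rw [Fintype.card_fin]
    omega
  obtain ⟨l, hl, hAl⟩ := hgap
  have hsub : A l ⊆ A (n - 1) := monotone_nat_of_le_succ hmono (by omega)
  refine ⟨(A l)ᶜ, ?_, ?_, ?_⟩
  · rw [Finset.nonempty_iff_ne_empty, Ne, Finset.compl_eq_empty_iff]
    intro h
    exact hne (Finset.univ_subset_iff.1 (h ▸ hsub))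
  · intro i hi
    rw [Finset.mem_compl, hA, not_le] at hi
    exact pos_of_mul_pos_right (lt_of_le_of_lt (Nat.cast_nonneg l) hi) (by positivity)
  · intro i hi j hj
    rw [hAl, Finset.mem_compl, hA, not_le] at hi
    rw [Finset.mem_compl, not_not, hA] at hj
    push_cast at hi
    linarith

/-! ### Reciprocity at the solution of the variational inequality -/

theorem theorem4 (n : ℕ)
    (u : Fin n → Bundle n → ℝ)
    (hu_nonneg : ∀ i b, 0 ≤ u i b)
    (hu_mono : ∀ i, Monotone (u i))
    (hu_cont : ∀ i, Continuous (u i))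
    (ψ : Fin n → Fin n → Bundle n → ℝ)
    (hψ : IsShareFamily u ψ)
    (hψ_cont : ∀ i j, Continuous (ψ i j)) :
    ∃ x : Exchange n, IsReciprocal u ψ x ∧ IsCoreStable u x := by
  rcases isEmpty_or_nonempty (Fin n) with hn | hn
  · exact ⟨fun _ _ => 0, fun i => hn.elim i, fun ⟨_, ⟨i, _⟩, _⟩ => hn.elim i⟩
  -- The slope `n ^ 2` makes the cutoff as narrow as the gap guaranteed by
  -- `exists_gap_of_mem_stdSimplex`.
  let x : (Fin n → ℝ) → Exchange n := rankExchange ((n : ℝ) ^ 2)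
  have hbundle : ∀ j, Continuous fun p => (x p).bundle j := fun j =>
    continuous_pi fun i => (continuous_apply j).comp
      ((continuous_apply i).comp (continuous_rankExchange _))
  have hcont : Continuous fun p => surplus u ψ (x p) := by
    refine continuous_pi fun i => ?_
    exact (continuous_finsetSum _ fun j _ => (hψ_cont i j).comp (hbundle j)).sub
      ((hu_cont i).comp (hbundle i))
  obtain ⟨p, hp, hmax⟩ := exists_mem_stdSimplex_forall_le hcont
  refine ⟨x p, ?_, isCoreStable_rankExchange hu_mono (by positivity) p⟩
  obtain ⟨U, ⟨i₀, hi₀⟩, hUpos, hUsum⟩ : ∃ U : Finset (Fin n), U.Nonempty ∧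
      (∀ i ∈ U, 0 < p i) ∧ ∑ i ∈ U, surplus u ψ (x p) i ≤ 0 := by
    by_cases h : ∃ k, p k = 0
    · obtain ⟨k, hk⟩ := h
      obtain ⟨U, hU, hUpos, hgap⟩ := exists_gap_of_mem_stdSimplex hp hk
      exact ⟨U, hU, hUpos, hψ.sum_surplus_nonpos fun i hi j hj =>
        rankExchange_eq_zero (hgap i hi j hj)⟩
    · push Not at h
      exact ⟨Finset.univ, Finset.univ_nonempty, fun i _ => (hp.1 i).lt_of_ne' (h i),
        (hψ.sum_surplus _).le⟩
  -- All members of `U` have the same maximal surplus, so a positive one at `i₀` would make the sum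
  -- over `U` positive.
  have hi₀le : surplus u ψ (x p) i₀ ≤ 0 := by
    by_contra! hpos
    refine absurd hUsum (not_le.2 (Finset.sum_pos (fun i hi => ?_) ⟨i₀, hi₀⟩))
    exact hpos.trans_le (hmax i (hUpos i hi) i₀)
  have hle : ∀ i, surplus u ψ (x p) i ≤ 0 := fun i => (hmax i₀ (hUpos i₀ hi₀) i).trans hi₀le
  exact fun i => (Finset.sum_eq_zero_iff_of_nonpos fun j _ => hle j).1 (hψ.sum_surplus _) i
    (Finset.mem_univ i)
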